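/- Let $d\ge 5$ be an odd integer and $N=(d-1)^2$. Let $X=\sum_{p\in\mathbf Z_d}|p+1\rangle\langle p|$ and $Z=\sum_p\zeta^p|p\rangle\langle p|$ with $\zeta=e^{2\pi i/d}$ be the Pauli operators on $\mathbf C^d$. For an operator $A$ on $\mathbf C^d$ let $\tilde A=\sum_{i=0}^{N-1} I^{\otimes i}\otimes A\otimes I^{\otimes(N-1-i)}$ be the collective operator on $(\mathbf C^d)^{\otimes N}$. Let $\mathcal E$ consist of the identity and the operators $\tilde S^{(p,q)},\tilde A^{(p,q)}$ ($0\le p<q\le d-1$) and $\tilde D^{(\ell)}$ ($0\le\ell\le d-2$), where $S^{(p,q)}=|p\rangle\langle q|+|q\rangle\langle p|$, $A^{(p,q)}=-i|p\rangle\langle q|+i|q\rangle\langle p|$ and $D^{(\ell)}=|\ell\rangle\langle\ell|-|\ell+1\rangle\langle\ell+1|$. For $\mathbf u=(u_0,\dots,u_{d-1})$ of non-negative integers with sum $N$, let $|S_{\mathbf u}\rangle$ be the (unnormalized) sum of all product basis vectors in which each $k$ occurs exactly $u_k$ times, let $\binom{N}{\mathbf u}=N!/(u_0!\cdots u_{d-1}!)$,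 and let $|S_{\mathbf u}\rangle\!\rangle$ be the sum of $|S_{\mathbf u'}\rangle$ over the distinct rearrangements $\mathbf u'$ of $\mathbf u$ that leave $u_0$ in its place. A code is an isometry $\mathcal C:\mathbf C^d\to\mathrm{Sym}^N(\mathbf C^d)$ with $\mathcal C X=X^{\otimes N}\mathcal C$ and $\mathcal C Z=Z^{\otimes N}\mathcal C$; put $|\overline k\rangle=\mathcal C|k\rangle$. It is error-correcting if it satisfies the Knill–Laflamme conditions for $\mathcal E$: there are constants $c_{(E,F)}$ with $\langle\overline i|E^\dagger F|\overline j\rangle=c_{(E,F)}\delta_{ij}$ for all $E,F\in\mathcal E$ and $i,j\in\mathbf Z_d$. It is SDPI (sparse doubly permutation-invariant) if (i) $|\overline 0\rangle$ is a linear combination of vectors $|S_{\mathbf w}\rangle\!\rangle$, where every rearrangement $\mathbf w'$ of $\mathbf w$ fixing the entry with index $0$ satisfies $\sum_k k w'_k\equiv 0 \pmod d$; and (ii) writing $|\overline 0\rangle=\sum_{\mathbf u}\alpha_{\mathbf u}|S_{\mathbf u}\rangle$, for all $\mathbf u,\mathbf u'$ with $\alpha_{\mathbf u},\alpha_{\mathbf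 u'}\ne0$ and all $\delta\in\mathbf Z_d$ one has $\sum_{\xi\in\mathbf Z_d}|u_\xi-u'_{\xi+\delta}|>4$ unless $\mathbf u=\mathbf u'$ and $\delta=0$. Let $\mathbf a=((d-1)^2,0,\dots,0)$, $\mathbf b=(d+1,d(d-3),0,\dots,0)$ and $\mathbf c=(0,d-1,\dots,d-1)$. Then there exists an error-correcting SDPI code with logical zero $$|\overline 0\rangle=\alpha_{\mathbf a}|S_{\mathbf a}\rangle\!\rangle+\alpha_{\mathbf b}|S_{\mathbf b}\rangle\!\rangle+\alpha_{\mathbf c}|S_{\mathbf c}\rangle\!\rangle,$$ where $$\alpha_{\mathbf a}=\sqrt{\frac{d^3-5d^2+d-1}{2d^4-6d^3}},\qquad \alpha_{\mathbf b}=\sqrt{\binom{N}{\mathbf b}^{-1}\frac{(d-1)(1-d\alpha_{\mathbf a}^2)}{d^2+d}},\qquad \alpha_{\mathbf c}=\sqrt{\binom{N}{\mathbf c}^{-1}\Bigl(1-\alpha_{\mathbf a}^2+(1-d)\binom{N}{\mathbf b}\alpha_{\mathbf b}^2\Bigr)}.$$ These three numbers are positive and, with $\|\alpha_{\mathbf u}\|^2=\binom{N}{\mathbf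 u}\alpha_{\mathbf u}^2$, they solve the system $$(d-1)^2\|\alpha_{\mathbf a}\|^2+(3d-1)\|\alpha_{\mathbf b}\|^2-(d-1)\|\alpha_{\mathbf c}\|^2=0,$$ $$(d-1)^4\|\alpha_{\mathbf a}\|^2-(d^4-5d^3+4d^2-5d+1)\|\alpha_{\mathbf b}\|^2+(d-1)^2\|\alpha_{\mathbf c}\|^2=0,$$ $$(d-1)^2\|\alpha_{\mathbf a}\|^2+(2d^3-4d^2-3d-1)\|\alpha_{\mathbf b}\|^2-(2d^2-3d+1)\|\alpha_{\mathbf c}\|^2=0.$$ -/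

import Mathlib

open scoped Matrix

noncomputable section

namespace SDPI

/-! ### The physical space `(ℂ^d)^{⊗N}` and its operators -/

/-- One qudit, `ℂ^d`, with orthonormal basis `|k⟩`, `k ∈ ℤ_d` (addition in `Fin d` is modulo `d`). -/
abbrev Qudit (d : ℕ) : Type := EuclideanSpace ℂ (Fin d)

/-- `(ℂ^d)^{⊗N}`, given by amplitudes in the product basis `|x₀⟩ ⊗ ⋯ ⊗ |x_{N-1}⟩`. -/
abbrev Qudits (d N : ℕ) : Type := EuclideanSpace ℂ (Fin N → Fin d)

/-- Matrices of operators on one qudit. -/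
abbrev Op (d : ℕ) : Type := Matrix (Fin d) (Fin d) ℂ

/-- Matrices of operators on `N` qudits, in the product basis. -/
abbrev Ops (d N : ℕ) : Type := Matrix (Fin N → Fin d) (Fin N → Fin d) ℂ

/-- The tensor product `A₀ ⊗ ⋯ ⊗ A_{N-1}`. -/
def tensor {d N : ℕ} (A : Fin N → Op d) : Ops d N :=
  Matrix.of fun x y => ∏ i, A i (x i) (y i)

/-- The tensor power `A^{⊗N}` (action of a group element on `N` qudits). -/
def tensorPow (d N : ℕ) (A : Op d) : Ops d N := tensor fun _ => A

/-- The collective operator `∑ᵢ I^{⊗i} ⊗ A ⊗ I^{⊗(N-1-i)}` (action of a Lie algebra element). -/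
def collective (d N : ℕ) (A : Op d) : Ops d N :=
  ∑ i, tensor fun j => if j = i then A else 1

/-- `|p⟩⟨q|`. -/
def ketbra {d : ℕ} (p q : Fin d) : Op d := Matrix.single p q 1

/-- The generalized Pauli shift `X = ∑ₚ |p+1⟩⟨p|`, addition modulo `d`. -/
def shiftX (d : ℕ) [NeZero d] : Op d := ∑ p : Fin d, ketbra (p + 1) p

/-- The generalized Pauli clock `Z = ∑ₚ ζ^p |p⟩⟨p|`, `ζ = exp(2πi/d)`. -/
def clockZ (d : ℕ) : Op d :=
  Matrix.diagonal fun p => Complex.exp (2 * Real.pi * Complex.I / d) ^ (p : ℕ)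

/-- `S^{(p,q)} = |p⟩⟨q| + |q⟩⟨p|`. -/
def opS {d : ℕ} (p q : Fin d) : Op d := ketbra p q + ketbra q p

/-- `A^{(p,q)} = -i|p⟩⟨q| + i|q⟩⟨p|`. -/
def opA {d : ℕ} (p q : Fin d) : Op d :=
  (-Complex.I) • ketbra p q + Complex.I • ketbra q p

/-- `D^{(ℓ)} = |ℓ⟩⟨ℓ| - |ℓ+1⟩⟨ℓ+1|`. -/
def opD {d : ℕ} [NeZero d] (l : Fin d) : Op d := ketbra l l - ketbra (l + 1) (l + 1)

/-- The error set: the identity and the collective generators `S̃^{(p,q)}`, `Ã^{(p,q)}` for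
`p < q`, and `D̃^{(ℓ)}` for `0 ≤ ℓ ≤ d-2`, of `su(d)`. -/
def errorSet (d N : ℕ) [NeZero d] : Set (Ops d N) :=
  {1} ∪ {E | ∃ p q : Fin d, p < q ∧ E = collective d N (opS p q)}
    ∪ {E | ∃ p q : Fin d, p < q ∧ E = collective d N (opA p q)}
    ∪ {E | ∃ l : Fin d, (l : ℕ) + 2 ≤ d ∧ E = collective d N (opD l)}

/-! ### Symmetric states -/

/-- `Sym^N(ℂ^d)`: the vectors invariant under all permutations of the `N` qudits. -/
def symPower (d N : ℕ) : Submodule ℂ (Qudits d N) where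
  carrier := {ψ | ∀ (σ : Equiv.Perm (Fin N)) (x : Fin N → Fin d), ψ (x ∘ σ) = ψ x}
  add_mem' := by
    intro ψ φ hψ hφ σ x
    simp [hψ σ x, hφ σ x]
  zero_mem' := by
    intro σ x
    simp
  smul_mem' := by
    intro c ψ hψ σ x
    simp [hψ σ x]

/-- The type (occupation numbers) of a word: how often each letter occurs. -/
def wordType {d N : ℕ} (x : Fin N → Fin d) : Fin d → ℕ :=
  fun k => (Finset.univ.filter fun i => x i = k).card

/-- `|S_u⟩`: the unnormalized sum of all product basis vectors of type `u`. -/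
def ketS {d : ℕ} (N : ℕ) (u : Fin d → ℕ) : Qudits d N :=
  WithLp.toLp 2 fun x => if wordType x = u then 1 else 0

/-- The distinct rearrangements of `w` that keep the entry with index `0` in its place. -/
def rearrangements {d : ℕ} [NeZero d] (w : Fin d → ℕ) : Finset (Fin d → ℕ) :=
  (Finset.univ.filter fun σ : Equiv.Perm (Fin d) => σ 0 = 0).image
    fun σ : Equiv.Perm (Fin d) => w ∘ (σ : Fin d → Fin d)

/-- `|S_w⟩⟩`: the sum of `|S_{w'}⟩` over those rearrangements `w'` of `w`. -/
def dketS {d : ℕ} [NeZero d] (N : ℕ) (w : Fin d → ℕ) : Qudits d N :=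
  ∑ w' ∈ rearrangements w, ketS N w'

/-- The types of total `N` all of whose rearrangements `w'` (with entry `0` fixed) satisfy
`∑ₖ k w'ₖ ≡ 0 (mod d)`, that is, `Z^{⊗N}|S_{w'}⟩ = |S_{w'}⟩`. -/
def doubleTypes (d N : ℕ) [NeZero d] : Set (Fin d → ℕ) :=
  {w | ∑ k, w k = N ∧ ∀ w' ∈ rearrangements w, d ∣ ∑ k : Fin d, (k : ℕ) * w' k}

/-! ### Codes -/

/-- A permutation-invariant code `ℂ^d → Sym^N(ℂ^d)`: an isometric encoding into the symmetric
power that intertwines the Pauli operators, so that `X^{⊗N}`, `Z^{⊗N}` act on the code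
words as the logical `X` and `Z`. -/
structure Code (d N : ℕ) [NeZero d] where
  enc : Qudit d →ₗᵢ[ℂ] Qudits d N
  mem_sym : ∀ v, enc v ∈ symPower d N
  enc_X : ∀ v, enc (Matrix.toEuclideanLin (shiftX d) v)
    = Matrix.toEuclideanLin (tensorPow d N (shiftX d)) (enc v)
  enc_Z : ∀ v, enc (Matrix.toEuclideanLin (clockZ d) v)
    = Matrix.toEuclideanLin (tensorPow d N (clockZ d)) (enc v)

variable {d N : ℕ} [NeZero d]

/-- The logical code word `|k̄⟩`. -/
def Code.logical (C : Code d N) (k : Fin d) : Qudits d N :=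
  C.enc (EuclideanSpace.single k 1)

/-- The Knill–Laflamme conditions for the error set:
`⟨ī|E†F|j̄⟩ = c_{(E,F)} δ_{ij}` for all errors `E`, `F`. -/
def Code.IsErrorCorrecting (C : Code d N) : Prop :=
  ∃ c : Ops d N → Ops d N → ℂ, ∀ E ∈ errorSet d N, ∀ F ∈ errorSet d N, ∀ i j : Fin d,
    inner ℂ (C.logical i) (Matrix.toEuclideanLin (Eᴴ * F) (C.logical j))
      = if i = j then c E F else 0

/-- Doubly permutation-invariant: `|0̄⟩` is a linear combination of the vectors `|S_w⟩⟩`.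
(The other code words are the shifts `|k̄⟩ = (X^{⊗N})^k |0̄⟩`.) -/
def Code.IsDoublyPermutationInvariant (C : Code d N) : Prop :=
  C.logical 0 ∈ Submodule.span ℂ (dketS N '' doubleTypes d N)

/-- `u` occurs in `|0̄⟩ = ∑ᵤ αᵤ|S_u⟩`, that is, `αᵤ ≠ 0`. The vectors `|S_u⟩` are orthogonal,
so this says that `⟨S_u|0̄⟩ ≠ 0`. -/
def Code.Occurs (C : Code d N) (u : Fin d → ℕ) : Prop :=
  inner ℂ (ketS N u) (C.logical 0) ≠ 0

/-- Sparse: for types `u`, `u'` that occur in `|0̄⟩` and a shift `δ`, the distance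
`∑_ξ |u_ξ - u'_{ξ+δ}|` exceeds `4`, unless `u = u'` and `δ = 0`. -/
def Code.IsSparse (C : Code d N) : Prop :=
  ∀ u u' : Fin d → ℕ, C.Occurs u → C.Occurs u' → ∀ δ : Fin d, ¬ (u = u' ∧ δ = 0) →
    4 < ∑ ξ, |(u ξ : ℤ) - (u' (ξ + δ) : ℤ)|

/-- Sparse doubly permutation-invariant. -/
def Code.IsSDPI (C : Code d N) : Prop :=
  C.IsSparse ∧ C.IsDoublyPermutationInvariant

/-! ### The types and coefficients of the code family -/

/-- `a = ((d-1)², 0, …, 0)`. -/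
def typeA (d : ℕ) [NeZero d] : Fin d → ℕ := fun k => if k = 0 then (d - 1) ^ 2 else 0

/-- `b = (d+1, d(d-3), 0, …, 0)`. -/
def typeB (d : ℕ) [NeZero d] : Fin d → ℕ :=
  fun k => if k = 0 then d + 1 else if k = 1 then d * (d - 3) else 0

/-- `c = (0, d-1, …, d-1)`. -/
def typeC (d : ℕ) [NeZero d] : Fin d → ℕ := fun k => if k = 0 then 0 else d - 1

/-- The multinomial coefficient `(∑ₖ uₖ)! / ∏ₖ uₖ!`, the squared norm of `|S_u⟩`. -/
def multi (u : Fin d → ℕ) : ℝ := (Nat.multinomial Finset.univ u : ℝ)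

def alphaA (d : ℕ) : ℝ :=
  Real.sqrt (((d : ℝ) ^ 3 - 5 * (d : ℝ) ^ 2 + d - 1) / (2 * (d : ℝ) ^ 4 - 6 * (d : ℝ) ^ 3))

def alphaB (d : ℕ) [NeZero d] : ℝ :=
  Real.sqrt ((multi (typeB d))⁻¹ *
    (((d : ℝ) - 1) * (1 - d * alphaA d ^ 2) / ((d : ℝ) ^ 2 + d)))

def alphaC (d : ℕ) [NeZero d] : ℝ :=
  Real.sqrt ((multi (typeC d))⁻¹ *
    (1 - alphaA d ^ 2 + (1 - (d : ℝ)) * (multi (typeB d) * alphaB d ^ 2)))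

/-- The weight `‖α_u‖² = ‖α_u |S_u⟩‖²` of a coefficient. -/
def weight (u : Fin d → ℕ) (α : ℝ) : ℝ := multi u * α ^ 2

end SDPI

end

/-!
Let `Ẽ_{pr}` be the collective operator of `|p⟩⟨r|`. Every error has the form `∑_{p,r} A_{pr}
Ẽ_{pr}`; this includes the identity, which is the collective operator of `N⁻¹ I`. On a symmetric
vector `∑ᵤ g(u) |S_u⟩` the operator `Ẽ_{pr}` acts by `g ↦ (u ↦ u_p g(u - e_p + e_r))`
(`collective_symState`). A product of two errors thus changes a type by at most `4` in the `ℓ¹`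
distance. Sparsity separates the types of different code words, and different types of one code
word, by more than `4`, so all Knill–Laflamme matrix elements vanish (`correlator_eq_zero`) except
those in which two errors restore the type. These are combinations of the moments `m_p = ⟨u_p⟩`
and `M_{pr} = ⟨u_p u_r⟩` of the occupation numbers in the distribution `|amplitude|²`
(`correlator_self`). The code words are cyclic shifts of each other, so their matrix elements
agree as soon as `m_p` is constant and `M_{pr}` depends only on whether `p = r`
(`amplitudeCode_isErrorCorrecting`).

As the logical zero is invariant under permutations of the nonzero letters, this amounts to `m₀ =
m₁`, `M₀₀ = M₁₁` and `M₀₁ = M₁₂`, which is equivalent to the linear system for the weights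
(`first_moment`, `second_moment`). The given coefficients solve this system and are normalized, by
their closed forms `weights_eq` and the count of words of a given type, `sum_ite_wordType_eq`.
Covariance under `Z` rests on `N = (d-1)² ≡ 1 (mod d)` and on `d ∣ ∑ₖ k uₖ` for the types `u` that
occur; for the type `c` this divisibility is where `d` odd enters.
-/

open scoped Matrix

namespace SDPI

variable {d N : ℕ}

/-! ### Collective operators on symmetric states -/

/-- The symmetric vector whose amplitude at a word is a function `g` of the type of that word:
`∑ᵤ g(u) |S_u⟩`, over the types of total `N`. -/
def symState (N : ℕ) (g : (Fin d → ℕ) → ℂ) : Qudits d N :=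
  WithLp.toLp 2 fun x => g (wordType x)

/-- The type obtained from `u` by turning one letter `p` into a letter `r`. The subtraction
truncates, so this has its meaning only if `1 ≤ u p`; it is used with a factor `u p` in front. -/
def move (u : Fin d → ℕ) (p r : Fin d) : Fin d → ℕ :=
  fun k => u k - (if k = p then 1 else 0) + (if k = r then 1 else 0)

lemma wordType_eq_sum (x : Fin N → Fin d) (k : Fin d) :
    wordType x k = ∑ i, if x i = k then 1 else 0 := by
  simp [wordType]

lemma wordType_update (x : Fin N → Fin d) (i : Fin N) (r : Fin d) :
    wordType (Function.update x i r) = move (wordType x) (x i) r := by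
  funext k
  have h : ∀ y : Fin N → Fin d, wordType y k
      = (if y i = k then 1 else 0) + ∑ j ∈ Finset.univ.erase i, if y j = k then 1 else 0 := by
    intro y
    rw [wordType_eq_sum]
    exact (Finset.add_sum_erase _ (fun j => if y j = k then 1 else 0) (Finset.mem_univ i)).symm
  have h' : (∑ j ∈ Finset.univ.erase i, if Function.update x i r j = k then 1 else 0)
      = ∑ j ∈ Finset.univ.erase i, if x j = k then 1 else 0 := by
    refine Finset.sum_congr rfl fun j hj => ?_
    rw [Function.update_of_ne (Finset.ne_of_mem_erase hj)]
  rw [move, h, h x, h', Function.update_self]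
  simp only [eq_comm (a := k)]
  omega

lemma symState_mem_symPower (g : (Fin d → ℕ) → ℂ) : symState N g ∈ symPower d N := by
  intro σ x
  have : wordType (x ∘ σ) = wordType x := by
    funext k
    simp only [wordType_eq_sum, Function.comp]
    exact Equiv.sum_comp σ fun i => if x i = k then 1 else 0
  simp [symState, this]

lemma inner_symState (g h : (Fin d → ℕ) → ℂ) :
    inner ℂ (symState N g) (symState N h)
      = ∑ x : Fin N → Fin d, star (g (wordType x)) * h (wordType x) := by
  simp [symState, PiLp.inner_apply, mul_comm]

/-- The matrix entry of the `i`-th summand of a collective operator: only words that differ from `x`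
at most at the site `i` contribute. -/
lemma prod_collective_apply (A : Op d) (i : Fin N) (x y : Fin N → Fin d) :
    ∏ j, (if j = i then A else 1) (x j) (y j)
      = ∑ r, if y = Function.update x i r then A (x i) r else 0 := by
  rw [Finset.sum_eq_single (y i)]
  · rw [← Finset.mul_prod_erase _ _ (Finset.mem_univ i), if_pos rfl]
    by_cases hy : y = Function.update x i (y i)
    · rw [if_pos hy, Finset.prod_eq_one, mul_one]
      intro j hj
      have hj' := Finset.ne_of_mem_erase hj
      rw [hy, Function.update_of_ne hj', if_neg hj', Matrix.one_apply_eq]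
    · rw [if_neg hy]
      obtain ⟨j, hj⟩ : ∃ j, y j ≠ Function.update x i (y i) j := by
        by_contra! hcon
        exact hy (funext hcon)
      have hji : j ≠ i := by
        rintro rfl
        simp at hj
      rw [Function.update_of_ne hji] at hj
      rw [Finset.prod_eq_zero (Finset.mem_erase.2 ⟨hji, Finset.mem_univ j⟩), mul_zero]
      rw [if_neg hji, Matrix.one_apply_ne (Ne.symm hj)]
  · intro r _ hr
    refine if_neg fun hy => hr ?_
    rw [hy, Function.update_self]
  · simp

/-- A collective operator acts on types: that of `|p⟩⟨r|` replaces the amplitude `g` by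
`u ↦ u_p g(u - e_p + e_r)`. -/
lemma collective_symState (A : Op d) (g : (Fin d → ℕ) → ℂ) :
    Matrix.toEuclideanLin (collective d N A) (symState N g)
      = symState N fun u => ∑ p, ∑ r, A p r * (u p * g (move u p r)) := by
  ext x
  change ∑ y, collective d N A x y * g (wordType y) = ∑ p, ∑ r, A p r * (wordType x p * g _)
  simp only [collective, Matrix.sum_apply, tensor, Matrix.of_apply, prod_collective_apply,
    Finset.sum_mul]
  rw [Finset.sum_comm]
  have h : ∀ i : Fin N, ∑ y, ∑ r, (if y = Function.update x i r then A (x i) r else 0)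
      * g (wordType y) = ∑ r, A (x i) r * g (move (wordType x) (x i) r) := by
    intro i
    rw [Finset.sum_comm]
    refine Finset.sum_congr rfl fun r _ => ?_
    simp [ite_mul, wordType_update]
  simp_rw [h]
  have h2 : ∀ i : Fin N, ∑ r, A (x i) r * g (move (wordType x) (x i) r)
      = ∑ p, if x i = p then ∑ r, A p r * g (move (wordType x) p r) else 0 := by
    intro i
    simp
  simp_rw [h2]
  rw [Finset.sum_comm]
  refine Finset.sum_congr rfl fun p _ => ?_
  have h3 : ((wordType x p : ℕ) : ℂ) = ∑ i, if x i = p then 1 else 0 := by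
    rw [wordType_eq_sum]; push_cast; rfl
  simp_rw [mul_left_comm (A p _), ← Finset.mul_sum]
  rw [h3, Finset.sum_mul]
  simp

lemma conjTranspose_collective (A : Op d) : (collective d N A)ᴴ = collective d N Aᴴ := by
  ext x y
  simp only [collective, tensor, Matrix.conjTranspose_apply, Matrix.sum_apply, Matrix.of_apply,
    star_sum, star_prod]
  refine Finset.sum_congr rfl fun i _ => Finset.prod_congr rfl fun j _ => ?_
  split_ifs
  · simp
  · rw [← Matrix.conjTranspose_apply, Matrix.conjTranspose_one]

/-- Collective operators include the multiples of the identity, so the identity error needs no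
separate treatment. -/
lemma collective_smul_one (c : ℂ) : collective d N (c • 1) = (c * N) • 1 := by
  have h : ∀ i : Fin N, (tensor fun j => if j = i then c • (1 : Op d) else 1) = c • 1 := by
    intro i
    ext x y
    have h1 : ∀ j, (if j = i then c • (1 : Op d) else 1) (x j) (y j)
        = (if j = i then c else 1) * (if x j = y j then 1 else 0) := by
      intro j
      split_ifs <;> simp_all [Matrix.one_apply]
    simp only [tensor, Matrix.of_apply, h1, Finset.prod_mul_distrib, Matrix.smul_apply,
      Matrix.one_apply, smul_eq_mul]
    congr 1
    · simp
    · by_cases hxy : x = y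
      · simp [hxy]
      · obtain ⟨j, hj⟩ := Function.ne_iff.1 hxy
        rw [if_neg hxy, Finset.prod_eq_zero (Finset.mem_univ j) (if_neg hj)]
  simp only [collective, h, Finset.sum_const, Finset.card_univ, Fintype.card_fin]
  rw [← Nat.cast_smul_eq_nsmul ℂ, smul_smul, mul_comm]

lemma exists_collective_of_mem_errorSet [NeZero d] (hN : N ≠ 0) {E : Ops d N}
    (hE : E ∈ errorSet d N) : ∃ A, E = collective d N A := by
  rcases hE with ((hE | ⟨p, q, -, rfl⟩) | ⟨p, q, -, rfl⟩) | ⟨l, -, rfl⟩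
  · refine ⟨((N : ℂ)⁻¹) • 1, ?_⟩
    rw [collective_smul_one, inv_mul_cancel₀ (by exact_mod_cast hN), one_smul]
    exact hE
  · exact ⟨_, rfl⟩
  · exact ⟨_, rfl⟩
  · exact ⟨_, rfl⟩

/-! ### Correlators of two collective errors -/

lemma sum_abs_move_sub_le (u : Fin d → ℕ) (p r : Fin d) :
    ∑ ξ, |(u ξ : ℤ) - (move u p r ξ : ℤ)| ≤ 2 := by
  calc ∑ ξ, |(u ξ : ℤ) - (move u p r ξ : ℤ)|
      ≤ ∑ ξ, ((if ξ = p then 1 else 0) + if ξ = r then 1 else 0) := by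
        refine Finset.sum_le_sum fun ξ _ => ?_
        simp only [move]
        rw [abs_le]
        split_ifs <;> omega
    _ = 2 := by simp [Finset.sum_add_distrib]

lemma sum_abs_move_move_sub_le (u : Fin d → ℕ) (p r p' r' : Fin d) :
    ∑ ξ, |(u ξ : ℤ) - (move (move u p r) p' r' ξ : ℤ)| ≤ 4 := by
  calc ∑ ξ, |(u ξ : ℤ) - (move (move u p r) p' r' ξ : ℤ)|
      ≤ ∑ ξ, (|(u ξ : ℤ) - (move u p r ξ : ℤ)|
          + |(move u p r ξ : ℤ) - (move (move u p r) p' r' ξ : ℤ)|) :=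
        Finset.sum_le_sum fun ξ _ => abs_sub_le _ _ _
    _ ≤ 2 + 2 := by
        rw [Finset.sum_add_distrib]
        exact add_le_add (sum_abs_move_sub_le _ _ _) (sum_abs_move_sub_le _ _ _)
    _ = 4 := by norm_num

lemma move_self {u : Fin d → ℕ} {p : Fin d} (hp : 1 ≤ u p) : move u p p = u := by
  funext k
  simp only [move]
  split_ifs with h
  · subst h; omega
  · omega

lemma move_move_cancel {u : Fin d → ℕ} {p r : Fin d} (hpr : p ≠ r) (hp : 1 ≤ u p) :
    move (move u p r) r p = u := by
  funext k
  simp only [move]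
  by_cases h : k = p
  · subst h; simp [hpr]; omega
  · by_cases h' : k = r
    · subst h'; simp [h]
    · simp [h, h']

/-- Two moves that return to the same type are both idle, or the second undoes the first. -/
lemma eq_of_move_move_eq {u : Fin d → ℕ} {p r p' r' : Fin d} (hp : 1 ≤ u p)
    (hp' : 1 ≤ move u p r p') (h : move (move u p r) p' r' = u) :
    (p = r ∧ p' = r') ∨ (p ≠ r ∧ p' = r ∧ r' = p) := by
  have key : ∀ k, (if k = p then 1 else 0) + (if k = p' then 1 else 0)
      = (if k = r then 1 else 0) + (if k = r' then 1 else 0 : ℕ) := by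
    intro k
    have hk := congrFun h k
    have h1 : (if k = p then 1 else 0) ≤ u k := by
      split_ifs with e
      · subst e; exact hp
      · omega
    have h2 : (if k = p' then 1 else 0) ≤ move u p r k := by
      split_ifs with e
      · subst e; exact hp'
      · omega
    rw [move] at hk
    rw [move] at hk h2
    omega
  have k1 := key p
  have k2 := key p'
  have k3 := key r
  by_cases e1 : p = r
  · subst e1
    left
    refine ⟨rfl, ?_⟩
    by_contra e2
    simp [e2] at k2
  · right
    simp only [e1, if_true, if_false] at k1 k3
    grind

/-- The matrix element between the states of amplitudes `g` and `h` of `Ẽ_{pr} Ẽ_{p'r'}`, where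
`Ẽ_{pr}` is the collective operator of `|p⟩⟨r|`. -/
def correlator (N : ℕ) (g h : (Fin d → ℕ) → ℝ) (p r p' r' : Fin d) : ℝ :=
  ∑ x : Fin N → Fin d, g (wordType x) * (wordType x p * (move (wordType x) p r p' *
    h (move (move (wordType x) p r) p' r')))

lemma inner_collective_collective (g h : (Fin d → ℕ) → ℝ) (A B : Op d) :
    inner ℂ (symState N fun u => (g u : ℂ)) (Matrix.toEuclideanLin
      ((collective d N A)ᴴ * collective d N B) (symState N fun u => (h u : ℂ)))
      = ∑ p, ∑ r, ∑ p', ∑ r', Aᴴ p r * B p' r' * (correlator N g h p r p' r' : ℂ) := by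
  rw [conjTranspose_collective, Matrix.toEuclideanLin, Matrix.toLpLin_mul _ 2,
    LinearMap.comp_apply]
  rw [← Matrix.toEuclideanLin, collective_symState, collective_symState, inner_symState]
  simp only [correlator, Complex.ofReal_sum, Finset.mul_sum]
  rw [Finset.sum_comm]
  refine Finset.sum_congr rfl fun p _ => ?_
  rw [Finset.sum_comm]
  refine Finset.sum_congr rfl fun r _ => ?_
  rw [Finset.sum_comm]
  refine Finset.sum_congr rfl fun p' _ => ?_
  rw [Finset.sum_comm]
  refine Finset.sum_congr rfl fun r' _ => ?_
  refine Finset.sum_congr rfl fun x _ => ?_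
  simp
  ring

lemma correlator_eq_zero {g h : (Fin d → ℕ) → ℝ}
    (hgh : ∀ u v, g u ≠ 0 → h v ≠ 0 → 4 < ∑ ξ, |(u ξ : ℤ) - (v ξ : ℤ)|) (p r p' r' : Fin d) :
    correlator N g h p r p' r' = 0 := by
  refine Finset.sum_eq_zero fun x _ => ?_
  by_contra hne
  simp only [mul_ne_zero_iff] at hne
  exact absurd (sum_abs_move_move_sub_le (wordType x) p r p' r')
    (not_le.2 (hgh _ _ hne.1 hne.2.2.2))

/-- For an amplitude whose support has minimum distance greater than `4`, the correlators of two
collective errors depend only on the first and second moments of the occupation numbers. If these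
moments do not distinguish letters, the correlators depend only on which indices coincide, which is
unchanged when all letters are shifted. -/
lemma correlator_self {g : (Fin d → ℕ) → ℝ} {α β μ : ℝ}
    (hg : ∀ u v, g u ≠ 0 → g v ≠ 0 → u ≠ v → 4 < ∑ ξ, |(u ξ : ℤ) - (v ξ : ℤ)|)
    (h2 : ∀ p r, ∑ x : Fin N → Fin d, (wordType x p : ℝ) * wordType x r * g (wordType x) ^ 2
      = if p = r then α else β)
    (h1 : ∀ p, ∑ x : Fin N → Fin d, (wordType x p : ℝ) * g (wordType x) ^ 2 = μ)
    (p r p' r' : Fin d) :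
    correlator N g g p r p' r'
      = if p = r ∧ p' = r' then (if p = p' then α else β)
        else if p' = r ∧ r' = p then β + μ else 0 := by
  rw [correlator]
  by_cases hA : p = r ∧ p' = r'
  · obtain ⟨rfl, rfl⟩ := hA
    rw [if_pos ⟨rfl, rfl⟩, ← h2]
    refine Finset.sum_congr rfl fun x _ => ?_
    rcases Nat.eq_zero_or_pos (wordType x p) with h | h
    · simp [h]
    · rw [move_self h]
      rcases Nat.eq_zero_or_pos (wordType x p') with h' | h'
      · simp [h']
      · rw [move_self h']
        ring
  rw [if_neg hA]
  by_cases hB : p' = r ∧ r' = p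
  · obtain ⟨rfl, rfl⟩ := hB
    have hne : r' ≠ p' := fun h => hA ⟨h, h.symm⟩
    have h2' := h2 r' p'
    rw [if_neg hne] at h2'
    rw [if_pos ⟨rfl, rfl⟩, ← h2', ← h1 r', ← Finset.sum_add_distrib]
    refine Finset.sum_congr rfl fun x _ => ?_
    rcases Nat.eq_zero_or_pos (wordType x r') with h | h
    · simp [h]
    · rw [move_move_cancel hne h]
      have : move (wordType x) r' p' p' = wordType x p' + 1 := by
        simp [move, hne.symm]
      rw [this]
      push_cast
      ring
  · rw [if_neg hB]
    refine Finset.sum_eq_zero fun x _ => ?_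
    by_contra hne
    simp only [mul_ne_zero_iff] at hne
    obtain ⟨ha, hb, hc, he⟩ := hne
    -- Minimum distance `> 4` forces the two moves to restore the type.
    have heq : wordType x = move (move (wordType x) p r) p' r' := by
      by_contra hcon
      exact absurd (sum_abs_move_move_sub_le (wordType x) p r p' r')
        (not_le.2 (hg _ _ ha he hcon))
    rcases eq_of_move_move_eq (Nat.one_le_iff_ne_zero.2 (by exact_mod_cast hb))
      (Nat.one_le_iff_ne_zero.2 (by exact_mod_cast hc)) heq.symm with h | h
    · exact hA h
    · exact hB h.2

/-! ### Codes from sparse amplitudes -/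

section

lemma tensorPow_clockZ_apply (ψ : Qudits d N) (x : Fin N → Fin d) :
    Matrix.toEuclideanLin (tensorPow d N (clockZ d)) ψ x
      = (∏ j, Complex.exp (2 * Real.pi * Complex.I / d) ^ (x j : ℕ)) * ψ x := by
  change ∑ y, (∏ j, clockZ d (x j) (y j)) * ψ y = _
  rw [Finset.sum_eq_single x]
  · simp [clockZ]
  · intro y _ hy
    obtain ⟨j, hj⟩ := Function.ne_iff.1 hy
    rw [Finset.prod_eq_zero (Finset.mem_univ j), zero_mul]
    exact Matrix.diagonal_apply_ne' _ hj
  · simp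

lemma clockZ_single (k : Fin d) :
    Matrix.toEuclideanLin (clockZ d) (EuclideanSpace.single k 1)
      = Complex.exp (2 * Real.pi * Complex.I / d) ^ (k : ℕ) • EuclideanSpace.single k 1 := by
  ext p
  change ∑ q, clockZ d p q * (EuclideanSpace.single k (1 : ℂ)) q = _
  simp only [clockZ, Matrix.diagonal_apply, PiLp.single_apply, PiLp.smul_apply,
    smul_eq_mul, mul_ite, mul_one, mul_zero, Finset.sum_ite_eq', Finset.mem_univ, if_true]
  split_ifs with h
  · rw [h]
  · rfl

lemma pow_fin_add [NeZero d] {ζ : ℂ} (hζ : ζ ^ d = 1) (a b : Fin d) :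
    ζ ^ ((a + b : Fin d) : ℕ) = ζ ^ (a : ℕ) * ζ ^ (b : ℕ) := by
  rw [Fin.val_add, ← pow_add, ← pow_eq_pow_mod _ hζ]

lemma sum_val_eq_sum_wordType (x : Fin N → Fin d) :
    ∑ j, (x j : ℕ) = ∑ k : Fin d, (k : ℕ) * wordType x k := by
  simp_rw [wordType_eq_sum, Finset.mul_sum]
  rw [Finset.sum_comm]
  simp

lemma qudit_hom_ext {E : Type*} [AddCommMonoid E] [Module ℂ E] {S T : Qudit d →ₗ[ℂ] E}
    (h : ∀ k, S (EuclideanSpace.single k 1) = T (EuclideanSpace.single k 1)) : S = T := by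
  refine (EuclideanSpace.basisFun (Fin d) ℂ).toBasis.ext fun k => ?_
  simpa using h k

/-- The code word `(X^{⊗N})^k ∑ᵤ f(u) |S_u⟩`, in terms of its amplitudes. -/
def codeKet (N : ℕ) (f : (Fin d → ℕ) → ℝ) (k : Fin d) : Qudits d N :=
  symState N fun u => (f fun ξ => u (ξ + k) : ℂ)

/-- The linear encoding sending `|k⟩` to `codeKet N f k`. -/
noncomputable def codeMap (N : ℕ) (f : (Fin d → ℕ) → ℝ) : Qudit d →ₗ[ℂ] Qudits d N :=
  (EuclideanSpace.basisFun (Fin d) ℂ).toBasis.constr ℂ (codeKet N f)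

lemma codeMap_single (f : (Fin d → ℕ) → ℝ) (k : Fin d) :
    codeMap N f (EuclideanSpace.single k 1) = codeKet N f k := by
  have := (EuclideanSpace.basisFun (Fin d) ℂ).toBasis.constr_basis ℂ (codeKet N f) k
  rwa [OrthonormalBasis.coe_toBasis, EuclideanSpace.basisFun_apply] at this

variable [NeZero d]

lemma wordType_sub_const (x : Fin N → Fin d) (k : Fin d) :
    wordType (fun j => x j - k) = fun ξ => wordType x (ξ + k) := by
  funext ξ
  simp only [wordType, sub_eq_iff_eq_add]

lemma shiftX_apply (p q : Fin d) : shiftX d p q = if p - 1 = q then 1 else 0 := by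
  simp only [shiftX, ketbra, Matrix.sum_apply, Matrix.single_apply]
  rw [Finset.sum_eq_single q]
  · simp only [and_true, sub_eq_iff_eq_add, eq_comm (a := q + 1)]
  · intro b _ hb
    simp [hb]
  · simp

lemma shiftX_single (k : Fin d) :
    Matrix.toEuclideanLin (shiftX d) (EuclideanSpace.single k 1)
      = EuclideanSpace.single (k + 1) 1 := by
  ext p
  change ∑ q, shiftX d p q * (EuclideanSpace.single k (1 : ℂ)) q = _
  simp only [shiftX_apply, PiLp.single_apply, ite_mul, one_mul, zero_mul,
    Finset.sum_ite_eq, Finset.mem_univ, if_true]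
  simp only [sub_eq_iff_eq_add]

lemma tensorPow_shiftX_symState (g : (Fin d → ℕ) → ℂ) :
    Matrix.toEuclideanLin (tensorPow d N (shiftX d)) (symState N g)
      = symState N fun u => g fun ξ => u (ξ + 1) := by
  ext x
  change ∑ y, (∏ j, shiftX d (x j) (y j)) * g (wordType y) = g fun ξ => wordType x (ξ + 1)
  rw [← wordType_sub_const]
  have h : ∀ y : Fin N → Fin d, ∏ j, shiftX d (x j) (y j)
      = if (fun j => x j - 1) = y then 1 else 0 := by
    intro y
    simp only [shiftX_apply, Finset.prod_ite_zero, Finset.prod_const_one, Finset.mem_univ,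
      true_imp_iff, funext_iff]
  simp [h]

lemma exp_pow_card : Complex.exp (2 * Real.pi * Complex.I / d) ^ d = 1 :=
  (Complex.isPrimitiveRoot_exp d (NeZero.ne d)).pow_eq_one

/-- The shift by `k` multiplies the `Z^{⊗N}`-eigenvalue `1` by `ζ^{kN}`, which is `ζ^k` because
`N ≡ 1 (mod d)`. -/
lemma tensorPow_clockZ_codeKet {f : (Fin d → ℕ) → ℝ}
    (hf : ∀ u, f u ≠ 0 → d ∣ ∑ k : Fin d, (k : ℕ) * u k) (hN : N ≡ 1 [MOD d]) (k : Fin d) :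
    Matrix.toEuclideanLin (tensorPow d N (clockZ d)) (codeKet N f k)
      = Complex.exp (2 * Real.pi * Complex.I / d) ^ (k : ℕ) • codeKet N f k := by
  ext x
  rw [tensorPow_clockZ_apply]
  change _ * ((f fun ξ => wordType x (ξ + k) : ℝ) : ℂ) =
    _ * ((f fun ξ => wordType x (ξ + k) : ℝ) : ℂ)
  rw [← wordType_sub_const]
  set ζ := Complex.exp (2 * Real.pi * Complex.I / d)
  have hζ : ζ ^ d = 1 := exp_pow_card
  by_cases h0 : f (wordType fun j => x j - k) = 0
  · simp [h0]
  congr 1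
  have hx : ∀ j, ζ ^ (x j : ℕ) = ζ ^ ((x j - k : Fin d) : ℕ) * ζ ^ (k : ℕ) := by
    intro j
    rw [← pow_fin_add hζ, sub_add_cancel]
  simp_rw [hx, Finset.prod_mul_distrib, Finset.prod_pow_eq_pow_sum]
  rw [sum_val_eq_sum_wordType (fun j => x j - k)]
  obtain ⟨m, hm⟩ := hf _ h0
  rw [hm, pow_mul, hζ, one_pow, one_mul, Finset.sum_const, Finset.card_univ, Fintype.card_fin,
    smul_eq_mul, pow_eq_pow_mod _ hζ, pow_eq_pow_mod (k : ℕ) hζ]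
  congr 1
  have := Nat.ModEq.mul_right (k : ℕ) hN
  rwa [one_mul] at this

/-- The distance between a type in the support of `f` and a cyclic shift of another one exceeds `4`,
except for a type and its own shift by `0`. -/
def SparseAmplitude (f : (Fin d → ℕ) → ℝ) : Prop :=
  ∀ u u' : Fin d → ℕ, f u ≠ 0 → f u' ≠ 0 → ∀ δ : Fin d, ¬ (u = u' ∧ δ = 0) →
    4 < ∑ ξ, |(u ξ : ℤ) - (u' (ξ + δ) : ℤ)|

lemma SparseAmplitude.shift {f : (Fin d → ℕ) → ℝ} (hf : SparseAmplitude f) {i j : Fin d}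
    {u v : Fin d → ℕ} (hu : f (fun ξ => u (ξ + i)) ≠ 0) (hv : f (fun ξ => v (ξ + j)) ≠ 0)
    (h : ¬ (i = j ∧ u = v)) : 4 < ∑ ξ, |(u ξ : ℤ) - (v ξ : ℤ)| := by
  have key := hf _ _ hu hv (i - j) (by
    rintro ⟨h1, h2⟩
    obtain rfl := sub_eq_zero.1 h2
    refine h ⟨rfl, funext fun ξ => ?_⟩
    simpa using congrFun h1 (ξ - i))
  rw [← Equiv.sum_comp (Equiv.addRight i)]
  simpa [add_assoc] using key

lemma sum_shift (F : (Fin d → ℕ) → ℝ) (k : Fin d) :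
    ∑ x : Fin N → Fin d, F (fun ξ => wordType x (ξ + k)) = ∑ x : Fin N → Fin d, F (wordType x) := by
  simp_rw [← wordType_sub_const]
  exact Equiv.sum_comp (Equiv.piCongrRight fun _ : Fin N => Equiv.subRight k)
    fun x => F (wordType x)

lemma orthonormal_codeKet {f : (Fin d → ℕ) → ℝ} (hf : SparseAmplitude f)
    (hnorm : ∑ x : Fin N → Fin d, f (wordType x) ^ 2 = 1) : Orthonormal ℂ (codeKet N f) := by
  rw [orthonormal_iff_ite]
  intro i j
  rw [codeKet, codeKet, inner_symState]
  split_ifs with hij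
  · subst hij
    have := sum_shift (N := N) (fun u => f u ^ 2) i
    rw [hnorm] at this
    rw [← Complex.ofReal_one, ← this, Complex.ofReal_sum]
    refine Finset.sum_congr rfl fun x _ => ?_
    simp [sq]
  · refine Finset.sum_eq_zero fun x _ => ?_
    by_contra hne
    simp only [mul_ne_zero_iff, star_ne_zero, Complex.ofReal_ne_zero] at hne
    have := hf.shift hne.1 hne.2 (fun h => hij h.1)
    simp at this

/-- The code with logical zero `∑ᵤ f(u) |S_u⟩`, for a normalized sparse amplitude `f` supported on
types fixed by `Z^{⊗N}`. -/
noncomputable def amplitudeCode (f : (Fin d → ℕ) → ℝ) (hf : SparseAmplitude f)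
    (hnorm : ∑ x : Fin N → Fin d, f (wordType x) ^ 2 = 1)
    (hZ : ∀ u, f u ≠ 0 → d ∣ ∑ k : Fin d, (k : ℕ) * u k) (hN : N ≡ 1 [MOD d]) : Code d N where
  enc := (codeMap N f).isometryOfOrthonormal
    (v := (EuclideanSpace.basisFun (Fin d) ℂ).toBasis)
    (by simp)
    (by
      convert orthonormal_codeKet hf hnorm using 1
      funext k
      simp [codeMap_single])
  mem_sym v := by
    change codeMap N f v ∈ _
    have : codeMap N f v = ∑ k, v k • codeKet N f k := by
      simp [codeMap, Module.Basis.constr_apply_fintype]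
    rw [this]
    exact Submodule.sum_mem _ fun k _ => Submodule.smul_mem _ _ (symState_mem_symPower _)
  enc_X v := by
    change codeMap N f _ = Matrix.toEuclideanLin _ (codeMap N f v)
    refine LinearMap.congr_fun (f := codeMap N f ∘ₗ Matrix.toEuclideanLin (shiftX d))
      (g := Matrix.toEuclideanLin (tensorPow d N (shiftX d)) ∘ₗ codeMap N f)
      (qudit_hom_ext fun k => ?_) v
    rw [LinearMap.comp_apply, LinearMap.comp_apply, shiftX_single, codeMap_single, codeMap_single,
      codeKet, codeKet, tensorPow_shiftX_symState]
    simp only [add_assoc]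
  enc_Z v := by
    change codeMap N f _ = Matrix.toEuclideanLin _ (codeMap N f v)
    refine LinearMap.congr_fun (f := codeMap N f ∘ₗ Matrix.toEuclideanLin (clockZ d))
      (g := Matrix.toEuclideanLin (tensorPow d N (clockZ d)) ∘ₗ codeMap N f)
      (qudit_hom_ext fun k => ?_) v
    rw [LinearMap.comp_apply, LinearMap.comp_apply, clockZ_single, map_smul, codeMap_single,
      tensorPow_clockZ_codeKet hZ hN]

section

variable {f : (Fin d → ℕ) → ℝ} (hf : SparseAmplitude f)
    (hnorm : ∑ x : Fin N → Fin d, f (wordType x) ^ 2 = 1)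
    (hZ : ∀ u, f u ≠ 0 → d ∣ ∑ k : Fin d, (k : ℕ) * u k) (hN : N ≡ 1 [MOD d])

lemma amplitudeCode_logical (k : Fin d) :
    (amplitudeCode f hf hnorm hZ hN).logical k = codeKet N f k :=
  codeMap_single f k

lemma amplitudeCode_logical_zero :
    (amplitudeCode f hf hnorm hZ hN).logical 0 = symState N fun u => (f u : ℂ) := by
  simp [amplitudeCode_logical, codeKet]

lemma amplitudeCode_isSparse : (amplitudeCode f hf hnorm hZ hN).IsSparse := by
  have h : ∀ u, (amplitudeCode f hf hnorm hZ hN).Occurs u → f u ≠ 0 := by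
    intro u hu h0
    refine hu ?_
    rw [amplitudeCode_logical_zero]
    change inner ℂ (symState N fun v => if v = u then 1 else 0) _ = 0
    rw [inner_symState]
    refine Finset.sum_eq_zero fun x _ => ?_
    split_ifs with hx
    · rw [hx, h0]; simp
    · simp
  exact fun u u' hu hu' => hf u u' (h u hu) (h u' hu')

/-- Equal first moments, and second moments that only depend on whether the two letters coincide,
make the code correct all collective errors. -/
lemma amplitudeCode_isErrorCorrecting (hN0 : N ≠ 0) {α β μ : ℝ}
    (h2 : ∀ p r, ∑ x : Fin N → Fin d, (wordType x p : ℝ) * wordType x r * f (wordType x) ^ 2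
      = if p = r then α else β)
    (h1 : ∀ p, ∑ x : Fin N → Fin d, (wordType x p : ℝ) * f (wordType x) ^ 2 = μ) :
    (amplitudeCode f hf hnorm hZ hN).IsErrorCorrecting := by
  refine ⟨fun E F => inner ℂ (codeKet N f 0) (Matrix.toEuclideanLin (Eᴴ * F) (codeKet N f 0)),
    fun E hE F hF i j => ?_⟩
  obtain ⟨A, rfl⟩ := exists_collective_of_mem_errorSet hN0 hE
  obtain ⟨B, rfl⟩ := exists_collective_of_mem_errorSet hN0 hF
  rw [amplitudeCode_logical, amplitudeCode_logical, codeKet.eq_1 N f i, codeKet.eq_1 N f j,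
    inner_collective_collective]
  split_ifs with hij
  · subst hij
    beta_reduce
    rw [codeKet, inner_collective_collective]
    have key : ∀ k : Fin d, ∀ p r p' r', correlator N (fun u => f fun ξ => u (ξ + k))
        (fun u => f fun ξ => u (ξ + k)) p r p' r'
        = if p = r ∧ p' = r' then (if p = p' then α else β)
          else if p' = r ∧ r' = p then β + μ else 0 := by
      intro k
      refine correlator_self (fun u v hu hv huv => hf.shift hu hv fun h => huv h.2) ?_ ?_
      · intro p r
        have e := sum_shift (N := N) (fun u => (u (p - k) : ℝ) * u (r - k) * f u ^ 2) k
        simp only [sub_add_cancel] at e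
        rw [e, h2]
        simp
      · intro p
        have e := sum_shift (N := N) (fun u => (u (p - k) : ℝ) * f u ^ 2) k
        simp only [sub_add_cancel] at e
        rw [e, h1]
    simp_rw [key]
  · refine Finset.sum_eq_zero fun p _ => Finset.sum_eq_zero fun r _ => Finset.sum_eq_zero
      fun p' _ => Finset.sum_eq_zero fun r' _ => ?_
    rw [correlator_eq_zero, Complex.ofReal_zero, mul_zero]
    exact fun u v hu hv => hf.shift hu hv fun h => hij h.1

end

end

/-! ### Counting words of a given type -/

lemma prod_X_word (x : Fin N → Fin d) :
    ∏ i, (MvPolynomial.X (x i) : MvPolynomial (Fin d) ℝ)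
      = MvPolynomial.monomial (Finsupp.equivFunOnFinite.symm (wordType x)) 1 := by
  rw [MvPolynomial.monomial_eq, Finsupp.prod_fintype _ _ (fun _ => pow_zero _)]
  have h : ∀ i, (MvPolynomial.X (x i) : MvPolynomial (Fin d) ℝ)
      = ∏ k, if x i = k then MvPolynomial.X k else 1 := by
    intro i
    simp
  simp_rw [h]
  rw [Finset.prod_comm]
  simp [Finset.prod_ite, wordType]

/-- The number of words of type `w` is a multinomial coefficient: compare the coefficients of
`∏ₖ Xₖ^{wₖ}` in the two expansions of `(∑ₖ Xₖ)^N`. -/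
lemma sum_ite_wordType_eq (w : Fin d → ℕ) (hw : ∑ k, w k = N) :
    ∑ x : Fin N → Fin d, (if wordType x = w then (1 : ℝ) else 0) = multi w := by
  classical
  have h1 := Fintype.sum_pow (fun k : Fin d => (MvPolynomial.X k : MvPolynomial (Fin d) ℝ)) N
  rw [Finset.sum_pow_eq_sum_piAntidiag] at h1
  have h2 := congrArg (MvPolynomial.coeff (Finsupp.equivFunOnFinite.symm w)) h1
  have h3 : ∀ v : Fin d → ℕ, ∏ k, (MvPolynomial.X k : MvPolynomial (Fin d) ℝ) ^ v k
      = MvPolynomial.monomial (Finsupp.equivFunOnFinite.symm v) 1 := by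
    intro v
    rw [MvPolynomial.monomial_eq, Finsupp.prod_fintype _ _ (fun _ => pow_zero _)]
    simp
  simp only [prod_X_word, h3, MvPolynomial.coeff_sum, MvPolynomial.coeff_monomial,
    EmbeddingLike.apply_eq_iff_eq, ← MvPolynomial.C_eq_coe_nat, MvPolynomial.coeff_C_mul] at h2
  rw [← h2, multi]
  simp [hw]

lemma multi_pos (w : Fin d → ℕ) : 0 < multi w := by
  unfold multi
  exact_mod_cast Nat.multinomial_pos _ _

lemma multi_comp_perm (w : Fin d → ℕ) (σ : Equiv.Perm (Fin d)) : multi (w ∘ σ) = multi w := by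
  unfold multi Nat.multinomial
  simp only [Function.comp]
  rw [Equiv.sum_comp σ w, Equiv.prod_comp σ fun i => (w i).factorial]

/-! ### Elementary estimates -/

lemma sq_pred_eq (hd : 5 ≤ d) : (d - 1) ^ 2 = d * (d - 3) + d + 1 := by
  obtain ⟨e, rfl⟩ := Nat.exists_eq_add_of_le' hd
  simp only [show e + 5 - 1 = e + 4 by omega, show e + 5 - 3 = e + 2 by omega]
  ring

lemma two_mul_le_peak (hd : 5 ≤ d) : 2 * d ≤ d * (d - 3) := by
  rw [mul_comm]
  exact Nat.mul_le_mul_left d (by omega)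

lemma sq_pred_modEq (hd : 5 ≤ d) : (d - 1) ^ 2 ≡ 1 [MOD d] := by
  have h : (d - 1) ^ 2 = 1 + d * (d - 2) := by
    obtain ⟨e, rfl⟩ := Nat.exists_eq_add_of_le' hd
    simp only [show e + 5 - 1 = e + 4 by omega, show e + 5 - 2 = e + 3 by omega]
    ring
  rw [h]
  simp [Nat.ModEq]

lemma four_lt_sum_of_one {u v : Fin d → ℕ} {δ : Fin d} (ξ : Fin d)
    (h : u ξ + 5 ≤ v (ξ + δ) ∨ v (ξ + δ) + 5 ≤ u ξ) :
    4 < ∑ ξ, |(u ξ : ℤ) - (v (ξ + δ) : ℤ)| := by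
  have h1 := Finset.single_le_sum (f := fun ξ => |(u ξ : ℤ) - (v (ξ + δ) : ℤ)|)
    (fun _ _ => abs_nonneg _) (Finset.mem_univ ξ)
  have h2 : 5 ≤ |(u ξ : ℤ) - (v (ξ + δ) : ℤ)| := by
    rw [le_abs]
    omega
  exact lt_of_lt_of_le (by omega) h1

lemma four_lt_sum_of_two {u v : Fin d → ℕ} {δ : Fin d} (ξ η : Fin d) (hne : ξ ≠ η)
    (h : u ξ + 4 ≤ v (ξ + δ) ∨ v (ξ + δ) + 4 ≤ u ξ)
    (h' : u η + 4 ≤ v (η + δ) ∨ v (η + δ) + 4 ≤ u η) :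
    4 < ∑ ξ, |(u ξ : ℤ) - (v (ξ + δ) : ℤ)| := by
  have h1 := Finset.add_le_sum (f := fun ξ => |(u ξ : ℤ) - (v (ξ + δ) : ℤ)|)
    (fun _ _ => abs_nonneg _) (Finset.mem_univ ξ) (Finset.mem_univ η) hne
  have h2 : 4 ≤ |(u ξ : ℤ) - (v (ξ + δ) : ℤ)| := by
    rw [le_abs]
    omega
  have h3 : 4 ≤ |(u η : ℤ) - (v (η + δ) : ℤ)| := by
    rw [le_abs]
    omega
  exact lt_of_lt_of_le (by omega) h1

lemma pos_of_weight_pos {α : ℝ} {u : Fin d → ℕ} (hα : 0 ≤ α) (h : 0 < weight u α) : 0 < α := by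
  refine lt_of_le_of_ne hα fun h0 => ?_
  simp [weight, ← h0] at h

/-! ### The types `a`, `b`, `c` and their rearrangements -/

variable [NeZero d]

lemma multi_of_mem_rearrangements {w w' : Fin d → ℕ} (h : w' ∈ rearrangements w) :
    multi w' = multi w ∧ ∑ k, w' k = ∑ k, w k := by
  simp only [rearrangements, Finset.mem_image] at h
  obtain ⟨σ, -, rfl⟩ := h
  exact ⟨multi_comp_perm w σ, Equiv.sum_comp σ w⟩

lemma dketS_eq_symState (w : Fin d → ℕ) :
    dketS N w = symState N fun u => if u ∈ rearrangements w then 1 else 0 := by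
  ext x
  simp [dketS, ketS, symState]

lemma sum_ite_mem_rearrangements (w : Fin d → ℕ) (hw : ∑ k, w k = N) (G : (Fin d → ℕ) → ℝ) :
    ∑ x : Fin N → Fin d, (if wordType x ∈ rearrangements w then G (wordType x) else 0)
      = multi w * ∑ w' ∈ rearrangements w, G w' := by
  have h : ∀ u : Fin d → ℕ, (if u ∈ rearrangements w then G u else 0)
      = ∑ w' ∈ rearrangements w, G w' * if u = w' then 1 else 0 := by
    intro u
    simp
  simp_rw [h]
  rw [Finset.sum_comm, Finset.mul_sum]
  refine Finset.sum_congr rfl fun w' hw' => ?_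
  obtain ⟨h1, h2⟩ := multi_of_mem_rearrangements hw'
  rw [← Finset.mul_sum, sum_ite_wordType_eq w' (h2.trans hw), h1, mul_comm]

/-- `(d+1, 0, …, 0, d(d-3), 0, …, 0)`, with `d(d-3)` at the index `k`: for `k ≠ 0` these are the
rearrangements of `b`. -/
def peakType (d : ℕ) [NeZero d] (k : Fin d) : Fin d → ℕ :=
  fun j => if j = 0 then d + 1 else if j = k then d * (d - 3) else 0

lemma rearrangements_typeA : rearrangements (typeA d) = {typeA d} := by
  ext u
  simp only [rearrangements, Finset.mem_image, Finset.mem_filter, Finset.mem_univ, true_and,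
    Finset.mem_singleton]
  constructor
  · rintro ⟨σ, hσ, rfl⟩
    funext j
    simp [typeA, ← Equiv.eq_symm_apply, σ.symm_apply_eq.2 hσ.symm]
  · rintro rfl
    exact ⟨1, rfl, rfl⟩

lemma rearrangements_typeC : rearrangements (typeC d) = {typeC d} := by
  ext u
  simp only [rearrangements, Finset.mem_image, Finset.mem_filter, Finset.mem_univ, true_and,
    Finset.mem_singleton]
  constructor
  · rintro ⟨σ, hσ, rfl⟩
    funext j
    simp [typeC, ← Equiv.eq_symm_apply, σ.symm_apply_eq.2 hσ.symm]
  · rintro rfl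
    exact ⟨1, rfl, rfl⟩

lemma fin_one_ne_zero (hd : 2 ≤ d) : (1 : Fin d) ≠ 0 := by
  rw [Ne, Fin.ext_iff, Fin.val_one', Nat.mod_eq_of_lt (by omega), Fin.val_zero]
  exact one_ne_zero

lemma rearrangements_typeB (hd : 2 ≤ d) :
    rearrangements (typeB d) = (Finset.univ.erase 0).image (peakType d) := by
  have h10 := fin_one_ne_zero hd
  ext u
  simp only [rearrangements, Finset.mem_image, Finset.mem_filter, Finset.mem_univ, true_and,
    Finset.mem_erase, and_true]
  constructor
  · rintro ⟨σ, hσ, rfl⟩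
    refine ⟨σ.symm 1, ?_, ?_⟩
    · rw [Ne, Equiv.symm_apply_eq, hσ]
      exact h10
    · funext j
      simp [typeB, peakType, ← Equiv.eq_symm_apply, σ.symm_apply_eq.2 hσ.symm]
  · rintro ⟨k, hk, rfl⟩
    refine ⟨Equiv.swap 1 k, Equiv.swap_apply_of_ne_of_ne h10.symm hk.symm, ?_⟩
    funext j
    have e1 : Equiv.swap 1 k j = 0 ↔ j = 0 := by
      rw [← Equiv.eq_symm_apply, Equiv.symm_swap,
        Equiv.swap_apply_of_ne_of_ne h10.symm hk.symm]
    have e2 : Equiv.swap 1 k j = 1 ↔ j = k := by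
      rw [← Equiv.eq_symm_apply, Equiv.symm_swap, Equiv.swap_apply_left]
    simp only [typeB, peakType, Function.comp, e1, e2]

lemma peakType_injOn (hd : 5 ≤ d) : Set.InjOn (peakType d) (Finset.univ.erase (0 : Fin d)) := by
  intro k hk l hl h
  by_contra hkl
  have hk0 : k ≠ 0 := by simpa using hk
  have := congrFun h k
  simp only [peakType, if_neg hk0, if_neg hkl, if_true] at this
  have : 0 < d * (d - 3) := Nat.mul_pos (by omega) (by omega)
  omega

lemma sum_typeA : ∑ k, typeA d k = (d - 1) ^ 2 := by simp [typeA]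

lemma sum_typeC : ∑ k, typeC d k = (d - 1) ^ 2 := by
  have : ∀ k : Fin d, typeC d k = if k ∈ Finset.univ.erase 0 then d - 1 else 0 := by
    intro k
    by_cases h : k = 0 <;> simp [typeC, h]
  simp_rw [this]
  rw [Finset.sum_ite_mem, Finset.univ_inter, Finset.sum_const, Finset.card_erase_of_mem
    (Finset.mem_univ _), Finset.card_univ, Fintype.card_fin, smul_eq_mul, sq]

lemma sum_mul_peakType {k : Fin d} (hk : k ≠ 0) (c : Fin d → ℕ) :
    ∑ j, c j * peakType d k j = c 0 * (d + 1) + c k * (d * (d - 3)) := by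
  rw [← Finset.add_sum_erase _ _ (Finset.mem_univ 0)]
  refine congrArg₂ (· + ·) ?_ ?_
  · simp [peakType]
  · rw [Finset.sum_eq_single k]
    · simp [peakType, hk]
    · intro j hj hjk
      simp [peakType, Finset.ne_of_mem_erase hj, hjk]
    · intro h
      exact absurd (Finset.mem_erase.2 ⟨hk, Finset.mem_univ k⟩) h

lemma sum_peakType (hd : 5 ≤ d) {k : Fin d} (hk : k ≠ 0) : ∑ j, peakType d k j = (d - 1) ^ 2 := by
  have := sum_mul_peakType hk fun _ => 1
  simp only [one_mul] at this
  rw [this, sq_pred_eq hd]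
  ring

lemma typeB_eq : typeB d = peakType d 1 := rfl

lemma sum_typeB (hd : 5 ≤ d) : ∑ j, typeB d j = (d - 1) ^ 2 := by
  rw [typeB_eq, sum_peakType hd (fin_one_ne_zero (by omega))]

lemma dvd_typeA : d ∣ ∑ k : Fin d, (k : ℕ) * typeA d k := by
  rw [Finset.sum_eq_zero]
  · exact dvd_zero d
  · intro k _
    by_cases h : k = 0 <;> simp [typeA, h]

lemma dvd_peakType {l : Fin d} (hl : l ≠ 0) : d ∣ ∑ k : Fin d, (k : ℕ) * peakType d l k := by
  rw [sum_mul_peakType hl fun k => (k : ℕ)]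
  simp only [Fin.val_zero, zero_mul, zero_add]
  exact ((dvd_mul_right d _).mul_left _)

lemma dvd_typeC (hodd : Odd d) : d ∣ ∑ k : Fin d, (k : ℕ) * typeC d k := by
  have h : ∀ k : Fin d, (k : ℕ) * typeC d k = (k : ℕ) * (d - 1) := by
    intro k
    by_cases h : k = 0 <;> simp [typeC, h]
  obtain ⟨m, hm⟩ := hodd
  simp_rw [h]
  rw [← Finset.sum_mul, Fin.sum_univ_eq_sum_range fun k => k]
  refine Dvd.dvd.mul_right ⟨m, ?_⟩ _
  have := Finset.sum_range_id_mul_two d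
  have h2 : d - 1 = m * 2 := by omega
  rw [h2, ← mul_assoc] at this
  exact Nat.eq_of_mul_eq_mul_right two_pos this

/-! ### The logical zero -/

/-- The amplitudes of the logical zero, as a function of the type. -/
noncomputable def zeroAmplitude (d : ℕ) [NeZero d] (u : Fin d → ℕ) : ℝ :=
  alphaA d * (if u ∈ rearrangements (typeA d) then 1 else 0)
    + alphaB d * (if u ∈ rearrangements (typeB d) then 1 else 0)
    + alphaC d * (if u ∈ rearrangements (typeC d) then 1 else 0)

lemma apply_zero_of_mem_rearrangements {w w' : Fin d → ℕ} (h : w' ∈ rearrangements w) :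
    w' 0 = w 0 := by
  simp only [rearrangements, Finset.mem_image, Finset.mem_filter, Finset.mem_univ, true_and] at h
  obtain ⟨σ, hσ, rfl⟩ := h
  simp [hσ]

lemma zeroAmplitude_sq (hd : 5 ≤ d) (u : Fin d → ℕ) :
    zeroAmplitude d u ^ 2 = alphaA d ^ 2 * (if u ∈ rearrangements (typeA d) then 1 else 0)
    + alphaB d ^ 2 * (if u ∈ rearrangements (typeB d) then 1 else 0)
    + alphaC d ^ 2 * (if u ∈ rearrangements (typeC d) then 1 else 0) := by
  have hN := sq_pred_eq hd
  have hP := two_mul_le_peak hd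
  have hA : u ∈ rearrangements (typeA d) → u 0 = (d - 1) ^ 2 :=
    fun h => (apply_zero_of_mem_rearrangements h).trans (by simp [typeA])
  have hB : u ∈ rearrangements (typeB d) → u 0 = d + 1 :=
    fun h => (apply_zero_of_mem_rearrangements h).trans (by simp [typeB])
  have hC : u ∈ rearrangements (typeC d) → u 0 = 0 :=
    fun h => (apply_zero_of_mem_rearrangements h).trans (by simp [typeC])
  unfold zeroAmplitude
  by_cases a : u ∈ rearrangements (typeA d)
  · have b : u ∉ rearrangements (typeB d) := fun b => by have := hA a; have := hB b; omega
    have c : u ∉ rearrangements (typeC d) := fun c => by have := hA a; have := hC c; omega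
    simp [a, b, c]
  by_cases b : u ∈ rearrangements (typeB d)
  · have c : u ∉ rearrangements (typeC d) := fun c => by have := hB b; have := hC c; omega
    simp [a, b, c]
  by_cases c : u ∈ rearrangements (typeC d) <;> simp [a, b, c]

/-- Expectation in the logical zero of a function of the occupation numbers. -/
lemma sum_mul_zeroAmplitude_sq (hd : 5 ≤ d) (G : (Fin d → ℕ) → ℝ) :
    ∑ x : Fin ((d - 1) ^ 2) → Fin d, G (wordType x) * zeroAmplitude d (wordType x) ^ 2
      = weight (typeA d) (alphaA d) * G (typeA d)
        + weight (typeB d) (alphaB d) * ∑ k ∈ Finset.univ.erase 0, G (peakType d k)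
        + weight (typeC d) (alphaC d) * G (typeC d) := by
  have hA := sum_ite_mem_rearrangements (typeA d) sum_typeA G
  have hB := sum_ite_mem_rearrangements (typeB d) (sum_typeB hd) G
  have hC := sum_ite_mem_rearrangements (typeC d) sum_typeC G
  rw [rearrangements_typeA, Finset.sum_singleton, ← rearrangements_typeA] at hA
  rw [rearrangements_typeC, Finset.sum_singleton, ← rearrangements_typeC] at hC
  rw [rearrangements_typeB (by omega), Finset.sum_image (peakType_injOn hd),
    ← rearrangements_typeB (by omega)] at hB
  have hx : ∀ u, G u * zeroAmplitude d u ^ 2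
      = alphaA d ^ 2 * (if u ∈ rearrangements (typeA d) then G u else 0)
        + alphaB d ^ 2 * (if u ∈ rearrangements (typeB d) then G u else 0)
        + alphaC d ^ 2 * (if u ∈ rearrangements (typeC d) then G u else 0) := by
    intro u
    rw [zeroAmplitude_sq hd, mul_add, mul_add, mul_left_comm, mul_left_comm (G u),
      mul_left_comm (G u)]
    simp only [mul_ite, mul_one, mul_zero]
  simp_rw [hx]
  rw [Finset.sum_add_distrib, Finset.sum_add_distrib, ← Finset.mul_sum, ← Finset.mul_sum,
    ← Finset.mul_sum, hA, hB, hC]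
  unfold weight
  ring

lemma type_of_zeroAmplitude_ne_zero (hd : 5 ≤ d) {u : Fin d → ℕ} (hu : zeroAmplitude d u ≠ 0) :
    u = typeA d ∨ (∃ k, k ≠ 0 ∧ u = peakType d k) ∨ u = typeC d := by
  by_contra! h
  obtain ⟨h1, h2, h3⟩ := h
  refine hu ?_
  rw [zeroAmplitude, rearrangements_typeA, rearrangements_typeC, rearrangements_typeB (by omega)]
  have : u ∉ (Finset.univ.erase 0).image (peakType d) := by
    simp only [Finset.mem_image, Finset.mem_erase, Finset.mem_univ, and_true, not_exists, not_and]
    exact fun k hk e => h2 k hk e.symm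
  simp [this, h1, h3]

lemma sparse_zeroAmplitude (hd : 5 ≤ d) : SparseAmplitude (zeroAmplitude d) := by
  intro u v hu hv δ hne
  have hN := sq_pred_eq hd
  have hP := two_mul_le_peak hd
  have a0 : typeA d 0 = d * (d - 3) + d + 1 := by simp [typeA, hN]
  have a1 : ∀ j, j ≠ 0 → typeA d j = 0 := fun j hj => by simp [typeA, hj]
  have b0 : ∀ k, peakType d k 0 = d + 1 := fun k => by simp [peakType]
  have b1 : ∀ k, k ≠ 0 → peakType d k k = d * (d - 3) := fun k hk => by simp [peakType, hk]
  have b2 : ∀ k j, j ≠ 0 → j ≠ k → peakType d k j = 0 := fun k j hj hjk => by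
    simp [peakType, hj, hjk]
  have b3 : ∀ k j, peakType d k j ≤ d * (d - 3) := fun k j => by
    simp only [peakType]; split_ifs <;> omega
  have b4 : ∀ k j, j ≠ 0 → peakType d k j = 0 ∨ peakType d k j = d * (d - 3) := fun k j hj => by
    simp only [peakType, if_neg hj]; split_ifs <;> simp
  have c0 : typeC d 0 = 0 := by simp [typeC]
  have c1 : ∀ j, j ≠ 0 → typeC d j = d - 1 := fun j hj => by simp [typeC, hj]
  have c2 : ∀ j, typeC d j ≤ d - 1 := fun j => by simp only [typeC]; split_ifs <;> omega
  generalize d * (d - 3) = P at *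
  rcases type_of_zeroAmplitude_ne_zero hd hu with rfl | ⟨k, hk, rfl⟩ | rfl <;>
  rcases type_of_zeroAmplitude_ne_zero hd hv with rfl | ⟨l, hl, rfl⟩ | rfl
  · have hδ : δ ≠ 0 := fun h => hne ⟨rfl, h⟩
    refine four_lt_sum_of_one 0 (Or.inr ?_)
    rw [zero_add, a1 δ hδ, a0]; omega
  · refine four_lt_sum_of_one 0 (Or.inr ?_)
    have := b3 l (0 + δ)
    rw [a0]; omega
  · refine four_lt_sum_of_one 0 (Or.inr ?_)
    have := c2 (0 + δ)
    rw [a0]; omega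
  · refine four_lt_sum_of_one (-δ) (Or.inl ?_)
    have := b3 k (-δ)
    rw [neg_add_cancel, a0]; omega
  · by_cases hδ : δ = 0
    · subst hδ
      have hkl : k ≠ l := by rintro rfl; exact hne ⟨rfl, rfl⟩
      refine four_lt_sum_of_one k (Or.inr ?_)
      rw [add_zero, b1 k hk, b2 l k hk hkl]; omega
    -- For `d = 5` the entries `d + 1` and `d(d-3)` differ by exactly `4`, so one coordinate is not
    -- enough.
    · refine four_lt_sum_of_two 0 (-δ) (by simpa [eq_comm] using hδ) ?_ ?_
      · rw [zero_add, b0]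
        rcases b4 l δ hδ with h | h <;> omega
      · rw [neg_add_cancel, b0]
        rcases b4 k (-δ) (neg_ne_zero.2 hδ) with h | h <;> omega
  · refine four_lt_sum_of_one k (Or.inr ?_)
    have := c2 (k + δ)
    rw [b1 k hk]; omega
  · refine four_lt_sum_of_one (-δ) (Or.inl ?_)
    have := c2 (-δ)
    rw [neg_add_cancel, a0]; omega
  · refine four_lt_sum_of_one (l - δ) (Or.inl ?_)
    have := c2 (l - δ)
    rw [sub_add_cancel, b1 l hl]; omega
  · have hδ : δ ≠ 0 := fun h => hne ⟨rfl, h⟩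
    refine four_lt_sum_of_two 0 (-δ) (by simpa [eq_comm] using hδ) ?_ ?_
    · rw [zero_add, c0, c1 δ hδ]; omega
    · rw [neg_add_cancel, c0, c1 (-δ) (neg_ne_zero.2 hδ)]; omega

/-! ### The weights and the moments -/

lemma multi_typeA : multi (typeA d) = 1 := by
  have h : typeA d = Pi.single 0 ((d - 1) ^ 2) := by
    funext k
    simp [typeA, Pi.single_apply]
  rw [multi, Nat.multinomial, h]
  have : ∏ i, ((Pi.single 0 ((d - 1) ^ 2) : Fin d → ℕ) i).factorial
      = ((d - 1) ^ 2).factorial := by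
    rw [Finset.prod_eq_single 0]
    · simp
    · intro b _ hb
      simp [hb]
    · simp
  rw [this]
  simp [Nat.div_self (Nat.factorial_pos _)]

/-- Closed forms of the weights, which in particular show that the radicands are not negative. -/
lemma weights_eq (hd : 5 ≤ d) :
    weight (typeA d) (alphaA d)
        = ((d : ℝ) ^ 3 - 5 * (d : ℝ) ^ 2 + d - 1) / (2 * (d : ℝ) ^ 3 * (d - 3)) ∧
      weight (typeB d) (alphaB d) = ((d : ℝ) - 1) ^ 3 / (2 * (d : ℝ) ^ 3 * (d - 3)) ∧
      weight (typeC d) (alphaC d) = ((d : ℝ) ^ 2 - 1) / (2 * (d : ℝ) ^ 2) := by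
  have hd5 : (5 : ℝ) ≤ d := by exact_mod_cast hd
  have h3 : (0 : ℝ) < d - 3 := by linarith
  have h0 : (0 : ℝ) < d := by linarith
  have h1 : (0 : ℝ) < d - 1 := by linarith
  have hA : alphaA d ^ 2
      = ((d : ℝ) ^ 3 - 5 * (d : ℝ) ^ 2 + d - 1) / (2 * (d : ℝ) ^ 3 * (d - 3)) := by
    have hden : 2 * (d : ℝ) ^ 4 - 6 * (d : ℝ) ^ 3 = 2 * (d : ℝ) ^ 3 * (d - 3) := by ring
    have hnum : (0 : ℝ) ≤ (d : ℝ) ^ 3 - 5 * (d : ℝ) ^ 2 + d - 1 := by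
      have : 0 ≤ (d : ℝ) ^ 2 * (d - 5) := mul_nonneg (by positivity) (by linarith)
      nlinarith
    rw [alphaA, hden, Real.sq_sqrt (by positivity)]
  have hB0 : ((d : ℝ) - 1) * (1 - d * alphaA d ^ 2) / ((d : ℝ) ^ 2 + d)
      = ((d : ℝ) - 1) ^ 3 / (2 * (d : ℝ) ^ 3 * (d - 3)) := by
    rw [hA]
    field_simp
    ring
  have hB : multi (typeB d) * alphaB d ^ 2 = ((d : ℝ) - 1) ^ 3 / (2 * (d : ℝ) ^ 3 * (d - 3)) := by
    have := multi_pos (typeB d)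
    rw [alphaB, hB0, Real.sq_sqrt (by positivity), mul_inv_cancel_left₀ this.ne']
  have hC0 : 1 - alphaA d ^ 2 + (1 - (d : ℝ)) * (multi (typeB d) * alphaB d ^ 2)
      = ((d : ℝ) ^ 2 - 1) / (2 * (d : ℝ) ^ 2) := by
    rw [hB, hA]
    field_simp
    ring
  refine ⟨?_, hB, ?_⟩
  · rw [weight, multi_typeA, one_mul, hA]
  · have := multi_pos (typeC d)
    have h2 : (0 : ℝ) ≤ (d : ℝ) ^ 2 - 1 := by nlinarith
    rw [weight, alphaC, hC0, Real.sq_sqrt (by positivity), mul_inv_cancel_left₀ this.ne']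

lemma alphas_pos (hd : 5 ≤ d) : 0 < alphaA d ∧ 0 < alphaB d ∧ 0 < alphaC d := by
  obtain ⟨hA, hB, hC⟩ := weights_eq hd
  have hd5 : (5 : ℝ) ≤ d := by exact_mod_cast hd
  have h3 : (0 : ℝ) < d - 3 := by linarith
  have h0 : (0 : ℝ) < d := by linarith
  have h1 : (0 : ℝ) < d - 1 := by linarith
  have hnum : (0 : ℝ) < (d : ℝ) ^ 3 - 5 * (d : ℝ) ^ 2 + d - 1 := by
    have : 0 ≤ (d : ℝ) ^ 2 * (d - 5) := mul_nonneg (by positivity) (by linarith)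
    nlinarith
  have h2 : (0 : ℝ) < (d : ℝ) ^ 2 - 1 := by nlinarith
  refine ⟨pos_of_weight_pos (u := typeA d) (Real.sqrt_nonneg _) (hA ▸ by positivity),
    pos_of_weight_pos (u := typeB d) (Real.sqrt_nonneg _) (hB ▸ by positivity),
    pos_of_weight_pos (u := typeC d) (Real.sqrt_nonneg _) (hC ▸ by positivity)⟩

lemma weights_system (hd : 5 ≤ d) :
    ((d : ℝ) - 1) ^ 2 * weight (typeA d) (alphaA d)
        + (3 * (d : ℝ) - 1) * weight (typeB d) (alphaB d)
        - ((d : ℝ) - 1) * weight (typeC d) (alphaC d) = 0 ∧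
      ((d : ℝ) - 1) ^ 4 * weight (typeA d) (alphaA d)
        - ((d : ℝ) ^ 4 - 5 * (d : ℝ) ^ 3 + 4 * (d : ℝ) ^ 2 - 5 * d + 1)
          * weight (typeB d) (alphaB d)
        + ((d : ℝ) - 1) ^ 2 * weight (typeC d) (alphaC d) = 0 ∧
      ((d : ℝ) - 1) ^ 2 * weight (typeA d) (alphaA d)
        + (2 * (d : ℝ) ^ 3 - 4 * (d : ℝ) ^ 2 - 3 * d - 1) * weight (typeB d) (alphaB d)
        - (2 * (d : ℝ) ^ 2 - 3 * d + 1) * weight (typeC d) (alphaC d) = 0 := by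
  obtain ⟨hA, hB, hC⟩ := weights_eq hd
  have hd5 : (5 : ℝ) ≤ d := by exact_mod_cast hd
  have h3 : (0 : ℝ) < d - 3 := by linarith
  have h0 : (0 : ℝ) < d := by linarith
  rw [hA, hB, hC]
  refine ⟨?_, ?_, ?_⟩ <;> field_simp <;> ring

lemma norm_zeroAmplitude (hd : 5 ≤ d) :
    ∑ x : Fin ((d - 1) ^ 2) → Fin d, zeroAmplitude d (wordType x) ^ 2 = 1 := by
  have h := sum_mul_zeroAmplitude_sq hd fun _ => 1
  simp only [one_mul, mul_one, Finset.sum_const, Finset.card_erase_of_mem (Finset.mem_univ _),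
    Finset.card_univ, Fintype.card_fin, nsmul_eq_mul] at h
  obtain ⟨hA, hB, hC⟩ := weights_eq hd
  have hd5 : (5 : ℝ) ≤ d := by exact_mod_cast hd
  have h3 : (0 : ℝ) < d - 3 := by linarith
  have h0 : (0 : ℝ) < d := by linarith
  rw [h, hA, hB, hC, Nat.cast_sub (by omega), Nat.cast_one]
  field_simp
  ring

lemma dvd_of_zeroAmplitude_ne_zero (hodd : Odd d) (hd : 5 ≤ d) (u : Fin d → ℕ)
    (hu : zeroAmplitude d u ≠ 0) : d ∣ ∑ k : Fin d, (k : ℕ) * u k := by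
  rcases type_of_zeroAmplitude_ne_zero hd hu with rfl | ⟨k, hk, rfl⟩ | rfl
  · exact dvd_typeA
  · exact dvd_peakType hk
  · exact dvd_typeC hodd

/-- The case `p = 0` agrees with `p ≠ 0` by the first equation of the system. -/
lemma first_moment (hd : 5 ≤ d) (p : Fin d) :
    ∑ x : Fin ((d - 1) ^ 2) → Fin d, (wordType x p : ℝ) * zeroAmplitude d (wordType x) ^ 2
      = weight (typeB d) (alphaB d) * (d * (d - 3)) + weight (typeC d) (alphaC d) * (d - 1) := by
  rw [sum_mul_zeroAmplitude_sq hd fun u => (u p : ℝ)]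
  obtain ⟨h, -, -⟩ := weights_system hd
  by_cases hp : p = 0
  · subst hp
    simp [typeA, peakType, typeC, Nat.cast_sub (show 1 ≤ d by omega)]
    linear_combination h
  · have hs : ∑ k ∈ Finset.univ.erase 0, (peakType d k p : ℝ) = d * (d - 3) := by
      simp [peakType, hp, Nat.cast_sub (show 3 ≤ d by omega)]
    rw [hs]
    simp [typeA, typeC, hp, Nat.cast_sub (show 1 ≤ d by omega)]

/-- With `M_{pr}` the second moments, the system gives `M₀₁ = M₁₂` (half the difference of the third
and first equations) and `M₀₀ = M₁₁` (the second equation plus that difference). -/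
lemma second_moment (hd : 5 ≤ d) (p r : Fin d) :
    ∑ x : Fin ((d - 1) ^ 2) → Fin d,
        (wordType x p : ℝ) * wordType x r * zeroAmplitude d (wordType x) ^ 2
      = if p = r then weight (typeB d) (alphaB d) * (d * (d - 3)) ^ 2
          + weight (typeC d) (alphaC d) * (d - 1) ^ 2
        else weight (typeC d) (alphaC d) * (d - 1) ^ 2 := by
  rw [sum_mul_zeroAmplitude_sq hd fun u => (u p : ℝ) * u r]
  obtain ⟨h1, h2, h3⟩ := weights_system hd
  have c1 := Nat.cast_sub (R := ℝ) (show 1 ≤ d by omega)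
  have c3 := Nat.cast_sub (R := ℝ) (show 3 ≤ d by omega)
  have hs : ∀ q : Fin d, q ≠ 0 → ∑ k ∈ Finset.univ.erase 0, (peakType d k q : ℝ)
      = d * (d - 3) := by
    intro q hq
    simp [peakType, hq, c3]
  by_cases hp : p = 0
  · subst hp
    by_cases hr : r = 0
    · subst hr
      simp [typeA, peakType, typeC, c1]
      linear_combination h2 + (h3 - h1)
    · have e : ∑ k ∈ Finset.univ.erase 0, (peakType d k 0 : ℝ) * peakType d k r
          = (d + 1) * (d * (d - 3)) := by
        rw [← hs r hr, Finset.mul_sum]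
        simp [peakType]
      rw [e, if_neg (Ne.symm hr)]
      simp [typeA, typeC, hr]
      linear_combination (h3 - h1) / 2
  · by_cases hr : r = 0
    · subst hr
      have e : ∑ k ∈ Finset.univ.erase 0, (peakType d k p : ℝ) * peakType d k 0
          = (d + 1) * (d * (d - 3)) := by
        rw [← hs p hp, Finset.mul_sum]
        simp [peakType, mul_comm]
      rw [e, if_neg hp]
      simp [typeA, typeC, hp]
      linear_combination (h3 - h1) / 2
    · have e : ∑ k ∈ Finset.univ.erase 0, (peakType d k p : ℝ) * peakType d k r
          = if p = r then ((d : ℝ) * (d - 3)) ^ 2 else 0 := by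
        split_ifs with hpr
        · subst hpr
          rw [Finset.sum_eq_single p]
          · simp [peakType, hp, c3, sq]
          · intro k _ hk
            simp [peakType, hp, hk.symm]
          · simp [hp]
        · refine Finset.sum_eq_zero fun k _ => ?_
          by_cases hk : p = k
          · subst hk
            simp [peakType, hr, Ne.symm hpr]
          · simp [peakType, hp, hk]
      rw [e]
      simp only [typeA, typeC, hp, hr, if_false, c1]
      split_ifs <;> push_cast <;> ring

lemma symState_zeroAmplitude :
    symState N (fun u => (zeroAmplitude d u : ℂ))
      = (alphaA d : ℂ) • dketS N (typeA d) + (alphaB d : ℂ) • dketS N (typeB d)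
          + (alphaC d : ℂ) • dketS N (typeC d) := by
  simp only [dketS_eq_symState]
  ext x
  simp only [symState, zeroAmplitude, PiLp.add_apply, PiLp.smul_apply, smul_eq_mul]
  split_ifs <;> simp

lemma typeA_mem_doubleTypes : typeA d ∈ doubleTypes d ((d - 1) ^ 2) := by
  refine ⟨sum_typeA, fun w' hw' => ?_⟩
  rw [rearrangements_typeA, Finset.mem_singleton] at hw'
  exact hw' ▸ dvd_typeA

lemma typeB_mem_doubleTypes (hd : 5 ≤ d) : typeB d ∈ doubleTypes d ((d - 1) ^ 2) := by
  refine ⟨sum_typeB hd, fun w' hw' => ?_⟩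
  rw [rearrangements_typeB (by omega), Finset.mem_image] at hw'
  obtain ⟨k, hk, rfl⟩ := hw'
  exact dvd_peakType (Finset.ne_of_mem_erase hk)

lemma typeC_mem_doubleTypes (hodd : Odd d) : typeC d ∈ doubleTypes d ((d - 1) ^ 2) := by
  refine ⟨sum_typeC, fun w' hw' => ?_⟩
  rw [rearrangements_typeC, Finset.mem_singleton] at hw'
  exact hw' ▸ dvd_typeC hodd

end SDPI

open SDPI in
theorem theorem10 (d : ℕ) [NeZero d] (hodd : Odd d) (hd : 5 ≤ d) :
    (∃ C : Code d ((d - 1) ^ 2),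
      C.IsSDPI ∧ C.IsErrorCorrecting ∧
      C.logical 0 =
        (alphaA d : ℂ) • dketS ((d - 1) ^ 2) (typeA d)
          + (alphaB d : ℂ) • dketS ((d - 1) ^ 2) (typeB d)
          + (alphaC d : ℂ) • dketS ((d - 1) ^ 2) (typeC d)) ∧
    (0 < alphaA d ∧ 0 < alphaB d ∧ 0 < alphaC d) ∧
    (((d : ℝ) - 1) ^ 2 * weight (typeA d) (alphaA d)
        + (3 * (d : ℝ) - 1) * weight (typeB d) (alphaB d)
        - ((d : ℝ) - 1) * weight (typeC d) (alphaC d) = 0 ∧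
      ((d : ℝ) - 1) ^ 4 * weight (typeA d) (alphaA d)
        - ((d : ℝ) ^ 4 - 5 * (d : ℝ) ^ 3 + 4 * (d : ℝ) ^ 2 - 5 * d + 1)
          * weight (typeB d) (alphaB d)
        + ((d : ℝ) - 1) ^ 2 * weight (typeC d) (alphaC d) = 0 ∧
      ((d : ℝ) - 1) ^ 2 * weight (typeA d) (alphaA d)
        + (2 * (d : ℝ) ^ 3 - 4 * (d : ℝ) ^ 2 - 3 * d - 1) * weight (typeB d) (alphaB d)
        - (2 * (d : ℝ) ^ 2 - 3 * d + 1) * weight (typeC d) (alphaC d) = 0) := by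
  refine ⟨?_, alphas_pos hd, weights_system hd⟩
  have hZ := dvd_of_zeroAmplitude_ne_zero hodd hd
  refine ⟨amplitudeCode (zeroAmplitude d) (sparse_zeroAmplitude hd) (norm_zeroAmplitude hd) hZ
    (sq_pred_modEq hd), ⟨amplitudeCode_isSparse _ _ _ _, ?_⟩, ?_, ?_⟩
  · rw [Code.IsDoublyPermutationInvariant, amplitudeCode_logical_zero, symState_zeroAmplitude]
    refine Submodule.add_mem _ (Submodule.add_mem _ ?_ ?_) ?_ <;>
      refine Submodule.smul_mem _ _ (Submodule.subset_span (Set.mem_image_of_mem _ ?_))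
    · exact typeA_mem_doubleTypes
    · exact typeB_mem_doubleTypes hd
    · exact typeC_mem_doubleTypes hodd
  · exact amplitudeCode_isErrorCorrecting _ _ _ _ (pow_ne_zero 2 (by omega)) (second_moment hd)
      (first_moment hd)
  · rw [amplitudeCode_logical_zero, symState_zeroAmplitude]
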